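/- Let $M$ be a matroid on a finite set $E$ with $|E|=n$, rank function $\mathrm{rk}$ and rank $k=\mathrm{rk}(E)$. Its Tutte polynomial is $$T_M(x,y)=\sum_{A\subseteq E}(x-1)^{k-\mathrm{rk}(A)}(y-1)^{|A|-\mathrm{rk}(A)}\in\mathbb Z[x,y].$$ A subset $F\subseteq E$ is *stressed* if both the restriction $M|_F$ and the contraction $M/F$ are uniform matroids; its *cusp* is $\mathrm{cusp}(F)=\{S\subseteq E: |S|=k,\ |S\cap F|\ge \mathrm{rk}(F)+1\}$. If $F$ is stressed, the *relaxation* $\mathrm{Rel}(M,F)$ is the matroid on $E$ whose bases are the bases of $M$ together with the members of $\mathrm{cusp}(F)$. For $0\le r\le k$, $i>r$ and $0\le j<k-r$ put $$\alpha^{i,j}_{r,k}(x,y)=\begin{cases}(x-1)^{k-i-j}\bigl(1-((x-1)(y-1))^{i-r}\bigr)&\text{if } i+j\le k,\\ (y-1)^{i+j-k}\bigl(1-((x-1)(y-1))^{k-r-j}\bigr)&\text{if } i+j>k.\end{cases}$$ (1) Let $F$ be a stressed subset of $M$ with non-empty cusp, and let $r=\mathrm{rk}(F)$, $h=|F|$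 and $\widetilde M=\mathrm{Rel}(M,F)$. Then $$T_{\widetilde M}(x,y)=T_M(x,y)+\sum_{i=r+1}^{h}\sum_{j=0}^{k-r-1}\binom{h}{i}\binom{n-h}{j}\,\alpha^{i,j}_{r,k}(x,y),$$ and $T_{\widetilde M}(x,y)-T_M(x,y)$ is a multiple of $x+y-xy$ in $\mathbb Z[x,y]$. (2) Suppose that $M$ is an *elementary split matroid*, that is, either a direct sum of two uniform matroids, or a connected split matroid. Here a *connected split matroid* is a connected matroid (one that is not a direct sum of two non-empty matroids) in which every split flacet is stressed, where a *split flacet* is a flat $F$ such that $M|_F$ and $M/F$ are connected, $0<\mathrm{rk}(F)<|F|$, and $E\setminus F$ contains an element that is not a coloop of $M$. Let $\lambda_{r,h}$ be the number of stressed subsets of $M$ with non-empty cusp that have rank $r$ and size $h$. Then $$T_M(x,y)=T_{U_{k,n}}(x,y)-\sum_{r=0}^{k}\sum_{h=0}^{n}\lambda_{r,h}\sum_{i=r+1}^{h}\sum_{j=0}^{k-r-1}\binom{h}{i}\binom{n-h}{j}\,\alpha^{i,j}_{r,k}(x,y),$$ where $U_{k,n}$ is the uniform matroid of rank $k$ on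 $n$ elements. -/

import Mathlib

namespace Matroid

variable {α : Type*}

/-- The rank of a set `A`, as a natural number (for matroids with finite ground set). -/
noncomputable def rk (M : Matroid α) (A : Set α) : ℕ := (M.eRk A).toNat

/-- The uniform matroid `U_{k,n}` on `n` elements: for `k ≤ n` its bases are the `k`-element
subsets. (The minimum only makes the definition total in `k` and `n`.) -/
noncomputable def uniform (k n : ℕ) : Matroid (Fin n) :=
  Matroid.ofIsBaseOfFinite (E := Set.univ) Set.finite_univ (fun B => B.ncard = min k n)
    (by
      obtain ⟨B, -, hB⟩ := Set.exists_subset_card_eq (s := (Set.univ : Set (Fin n)))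
        (n := min k n) (by simp [Set.ncard_univ])
      exact ⟨B, hB⟩)
    (by
      intro X Y hX hY a ha
      obtain ⟨b, hbY, hbX⟩ : ∃ b ∈ Y, b ∉ X := by
        by_contra! h
        have : Y = X := Set.eq_of_subset_of_ncard_le h (by omega) (Set.toFinite _)
        exact ha.2 (this ▸ ha.1)
      refine ⟨b, ⟨hbY, hbX⟩, ?_⟩
      exact (Set.ncard_exchange hbX ha.1).trans hX)
    (fun _ _ => Set.subset_univ _)

instance (k n : ℕ) : (uniform k n).Finite := ⟨Set.toFinite _⟩

/-- `M` is uniform: for some `k`, its bases are exactly the `k`-element subsets of the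
ground set. -/
def IsUniform (M : Matroid α) : Prop :=
  ∃ k : ℕ, ∀ B : Set α, M.IsBase B ↔ B ⊆ M.E ∧ B.encard = k

/-- A matroid is connected if it is not a direct sum of two non-empty matroids. -/
def IsConnected (M : Matroid α) : Prop :=
  ¬ ∃ (M₁ M₂ : Matroid α) (h : Disjoint M₁.E M₂.E),
    M₁.E.Nonempty ∧ M₂.E.Nonempty ∧ M = M₁.disjointSum M₂ h

/-- The cusp of `A`: the sets `S` of cardinality `rk(M)` with `|S ∩ A| ≥ rk(A) + 1`. -/
def cusp (M : Matroid α) (A : Set α) : Set (Set α) :=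
  {S | S ⊆ M.E ∧ S.ncard = M.rk M.E ∧ M.rk A + 1 ≤ (S ∩ A).ncard}

/-- `A` is stressed if both the restriction to `A` and the contraction by `A` are uniform. -/
def IsStressed (M : Matroid α) (A : Set α) : Prop :=
  A ⊆ M.E ∧ (M ↾ A).IsUniform ∧ (M ／ A).IsUniform

/-- A flacet is a flat `F` such that `M|F` and `M/F` are connected; it is a split flacet if
moreover `0 < rk(F) < |F|` and some element outside `F` is not a coloop. -/
def IsSplitFlacet (M : Matroid α) (F : Set α) : Prop :=
  M.IsFlat F ∧ (M ↾ F).IsConnected ∧ (M ／ F).IsConnected ∧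
    0 < M.rk F ∧ M.rk F < F.ncard ∧ ∃ e ∈ M.E \ F, ¬ M.IsColoop e

/-- A connected split matroid is a connected matroid all of whose split flacets are stressed. -/
def IsConnectedSplit (M : Matroid α) : Prop :=
  M.IsConnected ∧ ∀ F, M.IsSplitFlacet F → M.IsStressed F

/-- An elementary split matroid is a connected split matroid or a direct sum of two
uniform matroids. -/
def IsElementarySplit (M : Matroid α) : Prop :=
  M.IsConnectedSplit ∨
    ∃ (M₁ M₂ : Matroid α) (h : Disjoint M₁.E M₂.E),
      M₁.IsUniform ∧ M₂.IsUniform ∧ M = M₁.disjointSum M₂ h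

section Relaxation

variable {M : Matroid α} {A B S : Set α}

lemma IsBase.ncard_eq_rk_ground (hB : M.IsBase B) : B.ncard = M.rk M.E := by
  rw [rk, eRk_ground, ← hB.encard_eq_eRank, Set.ncard]

variable [M.Finite]

lemma IsBase.ncard_inter_le_rk (hB : M.IsBase B) (A : Set α) : (B ∩ A).ncard ≤ M.rk A := by
  have h := (hB.indep.inter_right A).encard_le_eRk_of_subset Set.inter_subset_right
  exact ENat.toNat_le_toNat h ((M.isRkFinite_set A).eRk_lt_top.ne)

lemma IsStressed.isBase_of_ncard_inter (hA : M.IsStressed A) (hSE : S ⊆ M.E)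
    (hS : S.ncard = M.rk M.E) (hSA : (S ∩ A).ncard = M.rk A) : M.IsBase S := by
  obtain ⟨hAE, ⟨c, hc⟩, ⟨d, hd⟩⟩ := hA
  have hfin : S.Finite := M.set_finite S hSE
  obtain ⟨J, hJ⟩ := M.exists_isBasis A
  have hJc := ((hc J).1 hJ.restrict_isBase).2
  have hrc : M.rk A = c := by rw [rk, ← hJ.encard_eq_eRk, hJc, ENat.toNat_natCast]
  have hI : M.IsBasis (S ∩ A) A := by
    refine (isBase_restrict_iff hAE).1 ((hc _).2 ⟨Set.inter_subset_right, ?_⟩)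
    rw [← (hfin.inter_of_left A).cast_ncard_eq, hSA, hrc]
  obtain ⟨B, hB, hIB⟩ := hI.indep.exists_isBase_superset
  have hBfin : B.Finite := M.set_finite B hB.subset_ground
  have hBA : B ∩ A = S ∩ A :=
    (hI.eq_of_subset_indep (hB.indep.inter_right A) (Set.subset_inter hIB Set.inter_subset_right)
      Set.inter_subset_right).symm
  have hBk := hB.ncard_eq_rk_ground
  have hBd : (B \ A).ncard + (B ∩ A).ncard = B.ncard := by
    rw [add_comm]; exact Set.ncard_inter_add_ncard_sdiff_eq_ncard B A hBfin
  have hSd : (S \ A).ncard + (S ∩ A).ncard = S.ncard := by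
    rw [add_comm]; exact Set.ncard_inter_add_ncard_sdiff_eq_ncard S A hfin
  -- `B \ A` is independent in the contraction, and so is contained in a base of it
  have hBind : (M ／ A).Indep (B \ A) := by
    rw [hI.contract_indep_iff]
    refine ⟨hB.indep.subset ?_, Set.disjoint_sdiff_right⟩
    exact Set.union_subset Set.sdiff_subset hIB
  obtain ⟨B', hB', hBB'⟩ := hBind.exists_isBase_superset
  have hB'd := ((hd B').1 hB').2
  have hB'fin : B'.Finite := Set.finite_of_encard_eq_coe hB'd
  have hB'ind := hI.contract_indep_iff.1 hB'.indep
  have hB'n : B'.ncard = d := by rw [Set.ncard, hB'd, ENat.toNat_natCast]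
  have hle1 : (B \ A).ncard ≤ d := hB'n ▸ Set.ncard_le_ncard hBB' hB'fin
  have hle2 : (B' ∪ (S ∩ A)).ncard ≤ M.rk M.E := by
    obtain ⟨B'', hB'', hs⟩ := hB'ind.1.exists_isBase_superset
    rw [← hB''.ncard_eq_rk_ground]
    exact Set.ncard_le_ncard hs (M.set_finite B'' hB''.subset_ground)
  rw [Set.ncard_union_eq (hB'ind.2.symm.mono_right Set.inter_subset_right) hB'fin
    (hfin.inter_of_left A)] at hle2
  have hSbase : (M ／ A).IsBase (S \ A) := by
    refine (hd _).2 ⟨Set.sdiff_subset_sdiff_left hSE, ?_⟩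
    rw [← (hfin.sdiff).cast_ncard_eq]
    rw [hBA] at hBd
    congr 1
    omega
  have hSind := (hI.contract_indep_iff.1 hSbase.indep).1
  rw [Set.sdiff_union_inter] at hSind
  obtain ⟨B'', hB'', hs⟩ := hSind.exists_isBase_superset
  have : S = B'' := Set.eq_of_subset_of_ncard_le hs (by rw [hB''.ncard_eq_rk_ground, hS])
    (M.set_finite B'' hB''.subset_ground)
  exact this ▸ hB''

lemma IsStressed.isBase_or_mem_cusp (hA : M.IsStressed A) (hSE : S ⊆ M.E)
    (hS : S.ncard = M.rk M.E) (hSA : M.rk A ≤ (S ∩ A).ncard) : M.IsBase S ∨ S ∈ M.cusp A := by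
  rcases hSA.eq_or_lt with h | h
  · exact Or.inl (hA.isBase_of_ncard_inter hSE hS h.symm)
  · exact Or.inr ⟨hSE, hS, h⟩

/-- The bases of `M` together with the cusp of a stressed subset satisfy the basis-exchange
property. -/
lemma IsStressed.exchangeProperty (hA : M.IsStressed A) :
    ExchangeProperty (fun B => M.IsBase B ∨ B ∈ M.cusp A) := by
  have hP : ∀ B, (M.IsBase B ∨ B ∈ M.cusp A) → B ⊆ M.E ∧ B.ncard = M.rk M.E := by
    rintro B (hB | hB)
    · exact ⟨hB.subset_ground, hB.ncard_eq_rk_ground⟩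
    · exact ⟨hB.1, hB.2.1⟩
  -- an exchange that keeps at least `rk(A)` elements in `A` is always allowed
  have key : ∀ X Y a b, (M.IsBase X ∨ X ∈ M.cusp A) → (M.IsBase Y ∨ Y ∈ M.cusp A) → a ∈ X →
      b ∈ Y → b ∉ X → M.rk A ≤ ((insert b (X \ {a})) ∩ A).ncard →
      (M.IsBase (insert b (X \ {a})) ∨ insert b (X \ {a}) ∈ M.cusp A) := by
    intro X Y a b hX hY ha hb hbX h
    refine hA.isBase_or_mem_cusp ?_ ?_ h
    · exact Set.insert_subset ((hP Y hY).1 hb) (Set.sdiff_subset.trans (hP X hX).1)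
    · rw [Set.ncard_exchange hbX ha, (hP X hX).2]
  intro X Y hX hY a ha
  have hXfin : X.Finite := M.set_finite X (hP X hX).1
  have hYfin : Y.Finite := M.set_finite Y (hP Y hY).1
  have hXk := (hP X hX).2
  have hYk := (hP Y hY).2
  by_cases hXc : X ∈ M.cusp A
  · obtain ⟨b, hbY, hbX⟩ : ∃ b ∈ Y, b ∉ X := by
      by_contra! h
      have : Y = X := Set.eq_of_subset_of_ncard_le h (by omega) hXfin
      exact ha.2 (this ▸ ha.1)
    refine ⟨b, ⟨hbY, hbX⟩, key X Y a b hX hY ha.1 hbY hbX ?_⟩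
    have h1 : ((X ∩ A) \ {a}).ncard ≤ ((insert b (X \ {a})) ∩ A).ncard := by
      refine Set.ncard_le_ncard ?_ ((hXfin.sdiff.insert b).inter_of_left A)
      rintro x ⟨⟨hx, hxA⟩, hxa⟩
      exact ⟨Or.inr ⟨hx, hxa⟩, hxA⟩
    have h2 := Set.pred_ncard_le_ncard_sdiff_singleton (X ∩ A) a
    have h3 := hXc.2.2
    omega
  have hXB : M.IsBase X := hX.resolve_right hXc
  by_cases hYB : M.IsBase Y
  · obtain ⟨b, hb, hB⟩ := hXB.exchange hYB ha
    exact ⟨b, hb, Or.inl hB⟩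
  have hYc : Y ∈ M.cusp A := hY.resolve_left hYB
  have hXr := hXB.ncard_inter_le_rk A
  have hYr := hYc.2.2
  by_cases hXeq : (X ∩ A).ncard = M.rk A
  · obtain ⟨b, hb, hbX⟩ := Set.exists_mem_notMem_of_ncard_lt_ncard
      (show (X ∩ A).ncard < (Y ∩ A).ncard by omega) (hXfin.inter_of_left A)
    have hbX' : b ∉ X := fun h => hbX ⟨h, hb.2⟩
    refine ⟨b, ⟨hb.1, hbX'⟩, key X Y a b hX hY ha.1 hb.1 hbX' ?_⟩
    rw [← hXeq]
    have h1 : (insert b ((X ∩ A) \ {a})).ncard ≤ ((insert b (X \ {a})) ∩ A).ncard := by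
      refine Set.ncard_le_ncard ?_ ((hXfin.sdiff.insert b).inter_of_left A)
      rintro x (rfl | ⟨⟨hx, hxA⟩, hxa⟩)
      · exact ⟨Or.inl rfl, hb.2⟩
      · exact ⟨Or.inr ⟨hx, hxa⟩, hxA⟩
    rw [Set.ncard_insert_of_notMem (fun h => hbX h.1)
      ((hXfin.inter_of_left A).sdiff)] at h1
    have h2 := Set.pred_ncard_le_ncard_sdiff_singleton (X ∩ A) a
    omega
  -- the remaining case `|X ∩ A| < rk(A)`: exchange with an auxiliary base
  obtain ⟨P, hPs, hPn⟩ := Set.exists_subset_card_eq (s := Y ∩ A) (n := M.rk A) (by omega)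
  have hXd : (X ∩ A).ncard + (X \ A).ncard = X.ncard :=
    Set.ncard_inter_add_ncard_sdiff_eq_ncard X A hXfin
  have hXa := Set.pred_ncard_le_ncard_sdiff_singleton (X \ A) a
  have hrk : M.rk A ≤ M.rk M.E := by
    have := Set.ncard_le_ncard (Set.inter_subset_left : Y ∩ A ⊆ Y) hYfin
    omega
  obtain ⟨Q, hQs, hQn⟩ := Set.exists_subset_card_eq (s := (X \ A) \ {a})
    (n := M.rk M.E - M.rk A) (by omega)
  have hPfin : P.Finite := (hYfin.inter_of_left A).subset hPs
  have hQfin : Q.Finite := (hXfin.sdiff.sdiff).subset hQs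
  have hPQ : Disjoint P Q :=
    Set.disjoint_left.2 fun x hxP hxQ => (hQs hxQ).1.2 (hPs hxP).2
  have hB : M.IsBase (P ∪ Q) := by
    refine hA.isBase_of_ncard_inter ?_ ?_ ?_
    · exact Set.union_subset (fun x hx => (hP Y hY).1 (hPs hx).1)
        (fun x hx => (hP X hX).1 (hQs hx).1.1)
    · rw [Set.ncard_union_eq hPQ hPfin hQfin]
      omega
    · rw [← hPn]
      congr 1
      ext x
      constructor
      · rintro ⟨hx | hx, hxA⟩
        · exact hx
        · exact absurd hxA (hQs hx).1.2
      · exact fun hx => ⟨Or.inl hx, (hPs hx).2⟩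
  have haPQ : a ∉ P ∪ Q := by
    rintro (h | h)
    · exact ha.2 (hPs h).1
    · exact (hQs h).2 rfl
  obtain ⟨b, hb, hbB⟩ := hXB.exchange hB ⟨ha.1, haPQ⟩
  refine ⟨b, ⟨?_, hb.2⟩, Or.inl hbB⟩
  rcases hb.1 with h | h
  · exact (hPs h).1
  · exact absurd (hQs h).1.1 hb.2

end Relaxation

/-- The relaxation `Rel(M, A)` of a stressed subset `A`: the matroid on the same ground set whose
bases are the bases of `M` together with the members of the cusp of `A`. -/
def relax (M : Matroid α) [M.Finite] (A : Set α) (hA : M.IsStressed A) : Matroid α :=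
  Matroid.ofIsBaseOfFinite (E := M.E) M.ground_finite
    (fun B => M.IsBase B ∨ B ∈ M.cusp A)
    (M.exists_isBase.imp fun _ hB => Or.inl hB)
    hA.exchangeProperty
    (by
      rintro B (hB | hB)
      · exact hB.subset_ground
      · exact hB.1)

instance (M : Matroid α) [M.Finite] (A : Set α) (hA : M.IsStressed A) :
    (M.relax A hA).Finite := ⟨M.ground_finite⟩

open MvPolynomial in
/-- The Tutte polynomial `T_M(x, y) = ∑_{A ⊆ E} (x-1)^(rk E - rk A) (y-1)^(|A| - rk A)`, an element
of `ℤ[x, y]` with `x = X 0` and `y = X 1`. -/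
noncomputable def tutte (M : Matroid α) [M.Finite] : MvPolynomial (Fin 2) ℤ :=
  ∑ A ∈ M.ground_finite.toFinset.powerset,
    (X 0 - 1) ^ (M.rk M.E - M.rk (A : Set α)) * (X 1 - 1) ^ (A.card - M.rk (A : Set α))

open MvPolynomial in
/-- The polynomials `α_{r,k}^{i,j}(x, y)`, used for `i > r` and `j < k - r` only. -/
noncomputable def tutteAlpha (r k i j : ℕ) : MvPolynomial (Fin 2) ℤ :=
  if i + j ≤ k then
    (X 0 - 1) ^ (k - i - j) * (1 - ((X 0 - 1) * (X 1 - 1)) ^ (i - r))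
  else
    (X 1 - 1) ^ (i + j - k) * (1 - ((X 0 - 1) * (X 1 - 1)) ^ (k - r - j))

/-- `λ_{r,h}`: the number of stressed subsets with non-empty cusp of rank `r` and size `h`. -/
noncomputable def numStressed (M : Matroid α) (r h : ℕ) : ℕ :=
  {F : Set α | M.IsStressed F ∧ (M.cusp F).Nonempty ∧ M.rk F = r ∧ F.ncard = h}.ncard

end Matroid

/-!
For a stressed subset `F` of rank `r`, relaxation changes the ranks of exactly those `A` with
`|A ∩ F| > r` and `|A \ F| < k - r`: their rank grows from `r + |A \ F|` to `min |A| k`, the rank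
in the uniform matroid. The summand of such an `A` changes by `α` evaluated at
`(|A ∩ F|, |A \ F|)`, and binomial coefficients count these sets.

In an elementary split matroid every set whose rank is smaller than in the uniform matroid is
raised in this way by exactly one stressed subset, so the increments of all stressed subsets add up
to `T_U - T_M`. Uniqueness holds because that subset is the closure of every circuit contained in
the set. For existence in a connected split matroid, extend a non-spanning circuit to a maximal
connected non-spanning set: this is a split flacet, hence stressed, and since its restriction is
uniform, it is the closure of the circuit.
-/

namespace TutteRelaxation

open Matroid

section Rank

variable {α : Type*} {M : Matroid α} {A C F X Y : Set α}

lemma cast_rk [M.RankFinite] (A : Set α) : (M.rk A : ℕ∞) = M.eRk A :=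
  ENat.natCast_toNat (M.isRkFinite_set A).eRk_lt_top.ne

lemma rk_mono [M.RankFinite] (h : X ⊆ Y) : M.rk X ≤ M.rk Y :=
  ENat.toNat_le_toNat (M.eRk_mono h) (M.isRkFinite_set Y).eRk_lt_top.ne

lemma rk_inter_add_rk_union_le [M.RankFinite] (X Y : Set α) :
    M.rk (X ∩ Y) + M.rk (X ∪ Y) ≤ M.rk X + M.rk Y := by
  have h := M.eRk_inter_add_eRk_union_le X Y
  simp only [← cast_rk] at h
  exact_mod_cast h

lemma rk_closure (X : Set α) : M.rk (M.closure X) = M.rk X := by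
  rw [rk, eRk_closure_eq, rk]

lemma rk_eq_ncard_of_indep (h : M.Indep A) : M.rk A = A.ncard := by
  rw [rk, h.eRk_eq_encard, Set.ncard]

lemma rk_le_ncard (hA : A.Finite) : M.rk A ≤ A.ncard :=
  ENat.toNat_le_toNat (M.eRk_le_encard A) hA.encard_lt_top.ne

lemma indep_iff_rk_eq_ncard [M.RankFinite] (hA : A.Finite) : M.Indep A ↔ M.rk A = A.ncard := by
  rw [indep_iff_eRk_eq_encard, ← cast_rk, ← hA.cast_ncard_eq, Nat.cast_inj]

lemma rk_add_one_of_isCircuit [M.RankFinite] (hC : M.IsCircuit C) : M.rk C + 1 = C.ncard := by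
  have h := hC.eRk_add_one_eq
  rw [← cast_rk, ← hC.finite.cast_ncard_eq] at h
  exact_mod_cast h

lemma exists_isBase_ncard_inter_eq (hA : A ⊆ M.E) :
    ∃ B, M.IsBase B ∧ (B ∩ A).ncard = M.rk A := by
  obtain ⟨I, hI⟩ := M.exists_isBasis A
  obtain ⟨B, hB, rfl⟩ := hI.exists_isBase
  exact ⟨B, hB, by rw [rk, hI.eRk_eq_encard, Set.ncard]⟩

lemma rk_restrict (h : X ⊆ A) : (M ↾ A).rk X = M.rk X := by
  rw [rk, M.restrict_eRk_eq h, rk]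

lemma rk_contract_add_rk [M.RankFinite] (hF : F ⊆ M.E) (hX : X ⊆ M.E \ F) :
    (M ／ F).rk X + M.rk F = M.rk (X ∪ F) := by
  obtain ⟨I, hI⟩ := M.exists_isBasis F
  obtain ⟨K, hK, hIK⟩ := hI.indep.subset_isBasis_of_subset
    (hI.subset.trans Set.subset_union_right) (Set.union_subset (hX.trans Set.sdiff_subset) hF)
  have hKF : K ∩ F = I := (hI.eq_of_subset_indep (hK.indep.inter_right F)
    (Set.subset_inter hIK hI.subset) Set.inter_subset_right).symm
  have hKX : (M ／ F).IsBasis (K \ F) X := by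
    have h := hK.contract_isBasis hI
      (hK.indep.subset (Set.union_subset Set.sdiff_subset hIK))
    rwa [Set.union_sdiff_right, (Set.subset_sdiff.1 hX).2.sdiff_eq_left] at h
  have hcard := Set.encard_sdiff_add_encard_inter K F
  rw [hKF, ← hKX.eRk_eq_encard, ← hI.eRk_eq_encard, ← hK.eRk_eq_encard] at hcard
  simp only [← cast_rk] at hcard
  exact_mod_cast hcard

lemma rk_contract_ground_add_rk [M.RankFinite] (hF : F ⊆ M.E) :
    (M ／ F).rk (M ／ F).E + M.rk F = M.rk M.E := by
  rw [contract_ground, rk_contract_add_rk hF subset_rfl, Set.sdiff_union_of_subset hF]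

lemma rk_eq_min_of_isUniform [M.Finite] (hM : M.IsUniform) (hA : A ⊆ M.E) :
    M.rk A = min A.ncard (M.rk M.E) := by
  obtain ⟨k, hk⟩ := hM
  have hbase : ∀ B ⊆ M.E, B.ncard = k → M.IsBase B := fun B hB h =>
    (hk B).2 ⟨hB, by rw [← (M.set_finite B hB).cast_ncard_eq, h]⟩
  have hrk : M.rk M.E = k := by
    obtain ⟨B, hB⟩ := M.exists_isBase
    rw [← hB.ncard_eq_rk_ground, Set.ncard, ((hk B).1 hB).2, ENat.toNat_natCast]
  rw [hrk]
  rcases le_total A.ncard k with h | h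
  · obtain ⟨B, hAB, hBE, hBk⟩ := Set.exists_subsuperset_card_eq hA h
      (hrk ▸ rk_le_ncard M.ground_finite)
    rw [rk_eq_ncard_of_indep ((hbase B hBE hBk).indep.subset hAB), min_eq_left h]
  · obtain ⟨B, hBA, hBk⟩ := Set.exists_subset_card_eq h
    rw [min_eq_right h]
    refine le_antisymm (hrk ▸ rk_mono hA) ?_
    rw [← hBk, ← rk_eq_ncard_of_indep (hbase B (hBA.trans hA) hBk).indep]
    exact rk_mono hBA

lemma uniform_isBase_iff {k n : ℕ} {B : Set (Fin n)} :
    (uniform k n).IsBase B ↔ B.ncard = min k n := Iff.rfl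

lemma isUniform_uniform (k n : ℕ) : (uniform k n).IsUniform := by
  refine ⟨min k n, fun B => ?_⟩
  rw [uniform_isBase_iff, ← (Set.toFinite B).cast_ncard_eq, Nat.cast_inj]
  exact (and_iff_right (Set.subset_univ B)).symm

lemma uniform_rk (k n : ℕ) (A : Set (Fin n)) :
    (uniform k n).rk A = min A.ncard (min k n) := by
  obtain ⟨B, hB⟩ := (uniform k n).exists_isBase
  rw [rk_eq_min_of_isUniform (isUniform_uniform k n) (Set.subset_univ A),
    ← hB.ncard_eq_rk_ground, uniform_isBase_iff.1 hB]

end Rank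

section Stressed

variable {α : Type*} {M : Matroid α} [M.Finite] {A B C F G S X : Set α}

lemma ncard_inter_add_ncard_sdiff (hA : A ⊆ M.E) (F : Set α) :
    (A ∩ F).ncard + (A \ F).ncard = A.ncard :=
  Set.ncard_inter_add_ncard_sdiff_eq_ncard A F (M.set_finite A hA)

lemma rk_eq_min_of_subset_stressed (hF : M.IsStressed F) (hX : X ⊆ F) :
    M.rk X = min X.ncard (M.rk F) := by
  have : (M ↾ F).Finite := ⟨M.set_finite F hF.1⟩
  rw [← rk_restrict hX, rk_eq_min_of_isUniform hF.2.1 hX, restrict_ground_eq,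
    rk_restrict subset_rfl]

lemma rk_union_stressed (hF : M.IsStressed F) (hX : X ⊆ M.E \ F) :
    M.rk (X ∪ F) = M.rk F + min X.ncard (M.rk M.E - M.rk F) := by
  rw [← rk_contract_add_rk hF.1 hX, rk_eq_min_of_isUniform hF.2.2 hX,
    ← rk_contract_ground_add_rk hF.1, Nat.add_sub_cancel, add_comm]

lemma rk_eq_of_rk_le_ncard_inter (hF : M.IsStressed F) (hA : A ⊆ M.E)
    (h : M.rk F ≤ (A ∩ F).ncard) :
    M.rk A = M.rk F + min (A \ F).ncard (M.rk M.E - M.rk F) := by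
  have hinter : M.rk (A ∩ F) = M.rk F := by
    rw [rk_eq_min_of_subset_stressed hF Set.inter_subset_right, min_eq_right h]
  have hunion : M.rk (A ∪ F) = M.rk A :=
    le_antisymm (by have := rk_inter_add_rk_union_le (M := M) A F; omega)
      (rk_mono Set.subset_union_left)
  rw [← hunion, ← Set.sdiff_union_self, rk_union_stressed hF (Set.sdiff_subset_sdiff_left hA)]

lemma indep_of_ncard_le (hF : M.IsStressed F) (hA : A ⊆ M.E) (hAF : (A ∩ F).ncard ≤ M.rk F)
    (hAF' : (A \ F).ncard ≤ M.rk M.E - M.rk F) : M.Indep A := by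
  obtain ⟨P, hAP, hPF, hP⟩ := Set.exists_subsuperset_card_eq
    (Set.inter_subset_right : A ∩ F ⊆ F) hAF (rk_le_ncard (M.set_finite F hF.1))
  have hinter : (P ∪ A \ F) ∩ F = P := by
    rw [Set.union_inter_distrib_right, Set.sdiff_inter_self, Set.union_empty,
      Set.inter_eq_left.2 hPF]
  have hdiff : (P ∪ A \ F) \ F = A \ F := by
    rw [Set.union_sdiff_distrib, Set.sdiff_eq_empty.2 hPF, Set.empty_union, sdiff_idem]
  have hE : P ∪ A \ F ⊆ M.E := Set.union_subset (hPF.trans hF.1) (Set.sdiff_subset.trans hA)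
  have hcard := ncard_inter_add_ncard_sdiff hE F
  have hrk := rk_eq_of_rk_le_ncard_inter hF hE (by rw [hinter, hP])
  rw [hinter, hdiff, hP] at hcard
  rw [hdiff, min_eq_left hAF', hcard] at hrk
  refine ((indep_iff_rk_eq_ncard (M.set_finite _ hE)).2 hrk).subset ?_
  calc A = A ∩ F ∪ A \ F := (Set.inter_union_sdiff A F).symm
    _ ⊆ P ∪ A \ F := Set.union_subset_union_left _ hAP

/-- For stressed `F`, the sets `A` whose rank grows when `F` is relaxed. -/
def IsRaised (M : Matroid α) (F A : Set α) : Prop :=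
  M.rk F < (A ∩ F).ncard ∧ (A \ F).ncard < M.rk M.E - M.rk F

lemma IsRaised.rk_eq (h : IsRaised M F A) (hF : M.IsStressed F) (hA : A ⊆ M.E) :
    M.rk A = M.rk F + (A \ F).ncard := by
  rw [rk_eq_of_rk_le_ncard_inter hF hA h.1.le, min_eq_left h.2.le]

lemma IsRaised.rk_lt (h : IsRaised M F A) (hF : M.IsStressed F) (hA : A ⊆ M.E) :
    M.rk A < min A.ncard (M.rk M.E) := by
  have hrk := h.rk_eq hF hA
  have hcard := ncard_inter_add_ncard_sdiff hA F
  obtain ⟨h₁, h₂⟩ := h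
  omega

lemma isRaised_of_dep_inter (hF : M.IsStressed F) (hA : A ⊆ M.E) (hdep : M.Dep (A ∩ F))
    (hrk : M.rk A < M.rk M.E) : IsRaised M F A := by
  have hinter : M.rk F < (A ∩ F).ncard := by
    by_contra! h
    refine hdep.not_indep ((indep_iff_rk_eq_ncard (M.set_finite _ hdep.subset_ground)).2 ?_)
    rw [rk_eq_min_of_subset_stressed hF Set.inter_subset_right, min_eq_left h]
  have hrkA := rk_eq_of_rk_le_ncard_inter hF hA hinter.le
  exact ⟨hinter, by omega⟩

lemma isFlat_of_isStressed (hF : M.IsStressed F) (hrk : M.rk F < M.rk M.E) : M.IsFlat F := by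
  rw [isFlat_iff_closure_eq]
  refine (M.subset_closure F hF.1).antisymm' fun e he => ?_
  by_contra heF
  have hins := rk_union_stressed hF
    (Set.singleton_subset_iff.2 (show e ∈ M.E \ F from ⟨M.closure_subset_ground F he, heF⟩))
  have hle : M.rk ({e} ∪ F) ≤ M.rk (M.closure F) := rk_mono
    (Set.union_subset (Set.singleton_subset_iff.2 he) (M.subset_closure F hF.1))
  rw [rk_closure] at hle
  rw [Set.ncard_singleton] at hins
  omega

-- A circuit with at most `rk F` elements in `F` would be independent.
lemma IsRaised.closure_eq_of_isCircuit (h : IsRaised M F A) (hF : M.IsStressed F)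
    (hA : A ⊆ M.E) (hC : M.IsCircuit C) (hCA : C ⊆ A) : M.closure C = F := by
  have hCdiff : (C \ F).ncard ≤ M.rk M.E - M.rk F :=
    (Set.ncard_le_ncard (Set.sdiff_subset_sdiff_left hCA) (M.set_finite A hA).sdiff).trans h.2.le
  have hCinter : M.rk F < (C ∩ F).ncard := by
    by_contra! hle
    exact hC.not_indep (indep_of_ncard_le hF hC.subset_ground hle hCdiff)
  have hCF : C ⊆ F := by
    have hrk := rk_eq_min_of_subset_stressed hF (Set.inter_subset_right : C ∩ F ⊆ F)
    have hdep : ¬ M.Indep (C ∩ F) := fun hi => by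
      rw [rk_eq_ncard_of_indep hi] at hrk
      omega
    exact Set.inter_eq_left.1
      (hC.eq_of_not_indep_subset hdep Set.inter_subset_left)
  have hrkC : M.rk C = M.rk F := by
    rw [rk_eq_min_of_subset_stressed hF hCF, min_eq_right]
    exact (Set.inter_eq_left.2 hCF ▸ hCinter).le
  rw [(M.isRkFinite_set C).closure_eq_closure_of_subset_of_eRk_ge_eRk hCF
    (by rw [← cast_rk, ← cast_rk, hrkC])]
  exact (isFlat_of_isStressed hF (by have := h.2; omega)).closure

lemma IsRaised.unique (h : IsRaised M F A) (h' : IsRaised M G A) (hF : M.IsStressed F)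
    (hG : M.IsStressed G) (hA : A ⊆ M.E) : F = G := by
  have hdep : M.Dep A := by
    refine (not_indep_iff hA).1 fun hi => ?_
    have := h.rk_lt hF hA
    rw [rk_eq_ncard_of_indep hi] at this
    omega
  obtain ⟨C, hCA, hC⟩ := hdep.exists_isCircuit_subset
  rw [← h.closure_eq_of_isCircuit hF hA hC hCA, h'.closure_eq_of_isCircuit hG hA hC hCA]

lemma IsRaised.exists_mem_cusp (h : IsRaised M F A) (hA : A ⊆ M.E) :
    ∃ S ∈ M.cusp F, min A.ncard (M.rk M.E) ≤ (S ∩ A).ncard := by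
  rcases le_total A.ncard (M.rk M.E) with hle | hle
  · obtain ⟨S, hAS, hSE, hS⟩ := Set.exists_subsuperset_card_eq hA hle
      (rk_le_ncard M.ground_finite)
    have hSF : (A ∩ F).ncard ≤ (S ∩ F).ncard := Set.ncard_le_ncard
      (Set.inter_subset_inter_left F hAS) ((M.set_finite S hSE).inter_of_left F)
    refine ⟨S, ⟨hSE, hS, h.1.trans_le hSF⟩, ?_⟩
    rw [Set.inter_eq_right.2 hAS]
    exact min_le_left _ _
  · obtain ⟨S, hAS, hSA, hS⟩ := Set.exists_subsuperset_card_eq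
      (Set.sdiff_subset : A \ F ⊆ A) (h.2.le.trans (Nat.sub_le _ _)) hle
    have hSF : S \ F = A \ F := (Set.sdiff_subset_sdiff_left hSA).antisymm
      fun x hx => ⟨hAS hx, hx.2⟩
    have hcardS := ncard_inter_add_ncard_sdiff (hSA.trans hA) F
    have hdiff := h.2
    rw [hSF] at hcardS
    refine ⟨S, ⟨hSA.trans hA, hS, by omega⟩, ?_⟩
    rw [Set.inter_eq_left.2 hSA, hS]
    exact min_le_right _ _

lemma ncard_inter_le_rk_of_mem_cusp (hF : M.IsStressed F) (hA : A ⊆ M.E)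
    (h : ¬ IsRaised M F A) (hS : S ∈ M.cusp F) : (S ∩ A).ncard ≤ M.rk A := by
  obtain ⟨hSE, hSk, hSF⟩ := hS
  have hSA : (S ∩ A).ncard ≤ S.ncard :=
    Set.ncard_le_ncard Set.inter_subset_left (M.set_finite S hSE)
  have hcardS := ncard_inter_add_ncard_sdiff hSE F
  rcases lt_or_ge (M.rk F) (A ∩ F).ncard with hAF | hAF
  · have hdiff : M.rk M.E - M.rk F ≤ (A \ F).ncard := not_lt.1 fun hlt => h ⟨hAF, hlt⟩
    rw [rk_eq_of_rk_le_ncard_inter hF hA hAF.le, min_eq_right hdiff]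
    omega
  · have hinter : (S ∩ A ∩ F).ncard ≤ (A ∩ F).ncard := Set.ncard_le_ncard
      (Set.inter_subset_inter_left F Set.inter_subset_right)
      ((M.set_finite A hA).inter_of_left F)
    have hdiff : ((S ∩ A) \ F).ncard ≤ (S \ F).ncard := Set.ncard_le_ncard
      (Set.sdiff_subset_sdiff_left Set.inter_subset_left) (M.set_finite S hSE).sdiff
    have hind : M.Indep (S ∩ A) := indep_of_ncard_le hF
      (Set.inter_subset_left.trans hSE) (hinter.trans hAF) (by omega)
    rw [← rk_eq_ncard_of_indep hind]
    exact rk_mono Set.inter_subset_right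

lemma relax_isBase_iff (hF : M.IsStressed F) :
    (M.relax F hF).IsBase B ↔ M.IsBase B ∨ B ∈ M.cusp F := Iff.rfl

lemma relax_rk_ground (hF : M.IsStressed F) : (M.relax F hF).rk M.E = M.rk M.E := by
  obtain ⟨B, hB⟩ := M.exists_isBase
  have hB' : (M.relax F hF).IsBase B := (relax_isBase_iff hF).2 (Or.inl hB)
  rw [← hB.ncard_eq_rk_ground]
  exact hB'.ncard_eq_rk_ground.symm

lemma IsRaised.relax_rk (h : IsRaised M F A) (hF : M.IsStressed F) (hA : A ⊆ M.E) :
    (M.relax F hF).rk A = min A.ncard (M.rk M.E) := by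
  obtain ⟨S, hS, hle⟩ := h.exists_mem_cusp hA
  have hbase : (M.relax F hF).IsBase S := (relax_isBase_iff hF).2 (Or.inr hS)
  refine le_antisymm (le_min (rk_le_ncard (M.set_finite A hA)) ?_)
    (hle.trans (hbase.ncard_inter_le_rk A))
  rw [← relax_rk_ground hF]
  exact rk_mono hA

lemma relax_rk_of_not_isRaised (hF : M.IsStressed F) (hA : A ⊆ M.E)
    (h : ¬ IsRaised M F A) : (M.relax F hF).rk A = M.rk A := by
  apply le_antisymm
  · obtain ⟨B, hB, hBA⟩ := exists_isBase_ncard_inter_eq (M := M.relax F hF) hA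
    rw [← hBA]
    rcases (relax_isBase_iff hF).1 hB with hB | hB
    · exact hB.ncard_inter_le_rk A
    · exact ncard_inter_le_rk_of_mem_cusp hF hA h hB
  · obtain ⟨B, hB, hBA⟩ := exists_isBase_ncard_inter_eq hA
    rw [← hBA]
    exact ((relax_isBase_iff hF).2 (Or.inl hB)).ncard_inter_le_rk A

end Stressed

section Connectivity

variable {α : Type*} {M M₁ M₂ : Matroid α} {A C G H I S W X : Set α} {e : α}

/-- `X` is a separator of the restriction of `M` to `H`: the ranks of `X` and of its complement
in `H` add up to the rank of `H`. Only one inequality is recorded, because the other one is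
subadditivity of the rank. -/
def IsSeparator (M : Matroid α) (H X : Set α) : Prop :=
  X ⊆ H ∧ M.rk X + M.rk (H \ X) ≤ M.rk H

lemma IsSeparator.sdiff (h : IsSeparator M H X) : IsSeparator M H (H \ X) :=
  ⟨Set.sdiff_subset, by rw [Set.sdiff_sdiff_cancel_left h.1, add_comm]; exact h.2⟩

lemma IsSeparator.inter [M.RankFinite] (h : IsSeparator M H X) (hS : S ⊆ H) :
    IsSeparator M S (S ∩ X) := by
  refine ⟨Set.inter_subset_left, ?_⟩
  have hX := rk_inter_add_rk_union_le (M := M) S X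
  have hXc := rk_inter_add_rk_union_le (M := M) (S ∪ X) (H \ X)
  have hinter : (S ∪ X) ∩ (H \ X) = S \ X := by
    rw [← Set.inter_sdiff_assoc, Set.inter_sdiff_right_comm, Set.union_sdiff_right,
      Set.inter_eq_left.2 (Set.sdiff_subset.trans hS)]
  have hunion : S ∪ X ∪ H \ X = H := by
    rw [Set.union_assoc, Set.union_sdiff_cancel h.1, Set.union_eq_right.2 hS]
  have hsep := h.2
  rw [hinter, hunion] at hXc
  rw [Set.sdiff_self_inter]
  omega

lemma IsSeparator.indep [M.RankFinite] (h : IsSeparator M H X) (hI : I ⊆ H)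
    (hIX : M.Indep (I ∩ X)) (hIX' : M.Indep (I \ X)) : M.Indep I := by
  have hfin : I.Finite := Set.inter_union_sdiff I X ▸ hIX.finite.union hIX'.finite
  refine (indep_iff_rk_eq_ncard hfin).2 (le_antisymm (rk_le_ncard hfin) ?_)
  have hrk := (h.inter hI).2
  rwa [Set.sdiff_self_inter, rk_eq_ncard_of_indep hIX, rk_eq_ncard_of_indep hIX',
    Set.ncard_inter_add_ncard_sdiff_eq_ncard I X hfin] at hrk

/-- A set is connected in `M` if the restriction of `M` to it has no separators but the trivial
ones. -/
def IsConnectedSet (M : Matroid α) (G : Set α) : Prop :=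
  ∀ X, IsSeparator M G X → X = ∅ ∨ X = G

lemma IsConnectedSet.subset_or_disjoint [M.RankFinite] (hG : IsConnectedSet M G)
    (hX : IsSeparator M H X) (hGH : G ⊆ H) : G ⊆ X ∨ Disjoint G X :=
  (hG _ (hX.inter hGH)).symm.imp Set.inter_eq_left.1 Set.disjoint_iff_inter_eq_empty.2

lemma IsConnectedSet.of_forall_separator [M.RankFinite] (hG : IsConnectedSet M G) (hGH : G ⊆ H)
    (h : ∀ X, IsSeparator M H X → G ⊆ X → X = H) : IsConnectedSet M H := by
  intro X hX
  rcases hG.subset_or_disjoint hX hGH with hGX | hGX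
  · exact Or.inr (h X hX hGX)
  · have hcompl := h (H \ X) hX.sdiff (Set.subset_sdiff.2 ⟨hGH, hGX⟩)
    left
    rw [← Set.sdiff_sdiff_cancel_left hX.1, hcompl, Set.sdiff_self]

lemma isConnectedSet_of_isCircuit [M.RankFinite] (hC : M.IsCircuit C) : IsConnectedSet M C := by
  intro X hX
  by_contra! hne
  have hXC : X ⊂ C := hX.1.ssubset_of_ne hne.2
  have hCX : C \ X ⊂ C := sdiff_lt hX.1 hne.1.ne_empty
  refine hC.not_indep (hX.indep subset_rfl ?_ (hC.ssubset_indep hCX))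
  rw [Set.inter_eq_right.2 hX.1]
  exact hC.ssubset_indep hXC

lemma IsConnectedSet.closure [M.RankFinite] [M.Loopless] (hG : IsConnectedSet M G)
    (hGE : G ⊆ M.E) : IsConnectedSet M (M.closure G) := by
  refine hG.of_forall_separator (M.subset_closure G hGE) fun X hX hGX => ?_
  have hrk : M.rk (M.closure G \ X) = 0 := by
    have hle := hX.2
    have hmono : M.rk G ≤ M.rk X := rk_mono hGX
    rw [rk_closure] at hle
    omega
  have hloops : M.closure G \ X ⊆ M.loops := by
    rw [← eRk_eq_zero_iff (Set.sdiff_subset.trans (M.closure_subset_ground G)), ← cast_rk, hrk,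
      Nat.cast_zero]
  rw [M.loops_eq_empty, Set.subset_empty_iff, Set.sdiff_eq_empty] at hloops
  exact hX.1.antisymm hloops

lemma disjointSum_restrict_left (h : Disjoint M₁.E M₂.E) :
    M₁.disjointSum M₂ h ↾ M₁.E = M₁ := by
  refine ext_indep rfl fun I (hI : I ⊆ M₁.E) => ?_
  rw [restrict_indep_iff, disjointSum_indep_iff, Set.inter_eq_left.2 hI,
    (h.mono_left hI).inter_eq]
  simp [hI, hI.trans Set.subset_union_left]

lemma disjointSum_contract_left (h : Disjoint M₁.E M₂.E) :
    M₁.disjointSum M₂ h ／ M₁.E = M₂ := by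
  have hground : (M₁.disjointSum M₂ h ／ M₁.E).E = M₂.E := by
    rw [contract_ground, disjointSum_ground_eq, Set.union_sdiff_left, h.symm.sdiff_eq_left]
  obtain ⟨B, hB⟩ := M₁.exists_isBase
  have hBM₂ : B ∩ M₂.E = ∅ := (h.mono_left hB.subset_ground).inter_eq
  have hbasis : (M₁.disjointSum M₂ h).IsBasis B M₁.E := by
    rw [← isBase_restrict_iff (by simp), disjointSum_restrict_left]
    exact hB
  refine ext_indep hground fun I hI => ?_
  rw [hground] at hI
  have hIM₁ : I ∩ M₁.E = ∅ := (h.symm.mono_left hI).inter_eq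
  rw [hbasis.contract_indep_iff_of_disjoint (h.mono_right hI), disjointSum_indep_iff,
    Set.union_inter_distrib_right, Set.union_inter_distrib_right, hIM₁, hBM₂,
    Set.inter_eq_left.2 hI, Set.inter_eq_left.2 hB.subset_ground]
  simp [hB.indep, hI.trans Set.subset_union_right,
    hB.subset_ground.trans Set.subset_union_left]

lemma isSeparator_disjointSum (h : Disjoint M₁.E M₂.E) [(M₁.disjointSum M₂ h).RankFinite] :
    IsSeparator (M₁.disjointSum M₂ h) (M₁.disjointSum M₂ h).E M₁.E := by
  obtain ⟨B, hB⟩ := (M₁.disjointSum M₂ h).exists_isBase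
  obtain ⟨hB₁, hB₂, hBE⟩ := disjointSum_isBase_iff.1 hB
  have hcompl : (M₁.E ∪ M₂.E) \ M₁.E = M₂.E := by
    rw [Set.union_sdiff_left, h.symm.sdiff_eq_left]
  have hBdiff : B \ M₁.E = B ∩ M₂.E := by
    rw [← hcompl, ← Set.inter_sdiff_assoc, Set.inter_eq_left.2 hBE]
  have hrk₁ : (M₁.disjointSum M₂ h).rk M₁.E = (B ∩ M₁.E).ncard := by
    rw [hB₁.ncard_eq_rk_ground, ← rk_restrict subset_rfl, disjointSum_restrict_left]
  have hrk₂ : (M₁.disjointSum M₂ h).rk M₂.E = (B ∩ M₂.E).ncard := by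
    rw [hB₂.ncard_eq_rk_ground, ← rk_restrict subset_rfl, disjointSum_comm,
      disjointSum_restrict_left]
  refine ⟨by simp, le_of_eq ?_⟩
  rw [← hB.ncard_eq_rk_ground, disjointSum_ground_eq, hcompl, hrk₁, hrk₂, ← hBdiff,
    Set.ncard_inter_add_ncard_sdiff_eq_ncard B M₁.E hB.finite]

lemma IsSeparator.eq_disjointSum [M.RankFinite] (h : IsSeparator M M.E X) :
    ∃ hd : Disjoint (M ↾ X).E (M ↾ (M.E \ X)).E,
      M = (M ↾ X).disjointSum (M ↾ (M.E \ X)) hd := by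
  have hd : Disjoint (M ↾ X).E (M ↾ (M.E \ X)).E := by
    rw [restrict_ground_eq, restrict_ground_eq]
    exact Set.disjoint_sdiff_right
  refine ⟨hd, ext_indep ?_ fun I hI => ?_⟩
  · rw [disjointSum_ground_eq, restrict_ground_eq, restrict_ground_eq, Set.union_sdiff_cancel h.1]
  have hdiff : I ∩ (M.E \ X) = I \ X := by
    rw [← Set.inter_sdiff_assoc, Set.inter_eq_left.2 hI]
  rw [disjointSum_indep_iff, restrict_ground_eq, restrict_ground_eq, Set.union_sdiff_cancel h.1,
    restrict_indep_iff, restrict_indep_iff, hdiff]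
  exact ⟨fun hi => ⟨⟨hi.inter_right X, Set.inter_subset_right⟩,
      ⟨hi.subset Set.sdiff_subset, Set.sdiff_subset_sdiff_left hI⟩, hI⟩,
    fun hi => h.indep hI hi.1.1 hi.2.1.1⟩

lemma isConnected_iff_isConnectedSet [M.RankFinite] :
    M.IsConnected ↔ IsConnectedSet M M.E := by
  constructor
  · intro hM X hX
    by_contra! hne
    obtain ⟨hd, heq⟩ := hX.eq_disjointSum
    exact hM ⟨_, _, hd, hne.1, Set.sdiff_nonempty.2 fun hEX => hne.2 (hX.1.antisymm hEX), heq⟩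
  · rintro hM ⟨M₁, M₂, h, hM₁, ⟨e, he⟩, rfl⟩
    have heE : e ∈ (M₁.disjointSum M₂ h).E := by simp [he]
    rcases hM _ (isSeparator_disjointSum h) with hempty | hfull
    · exact hM₁.ne_empty hempty
    · exact h.notMem_of_mem_right he (hfull ▸ heE)

lemma IsConnectedSet.isConnected_restrict [M.RankFinite] (hG : IsConnectedSet M G) :
    (M ↾ G).IsConnected := by
  refine isConnected_iff_isConnectedSet.2 fun X hX => hG X ⟨hX.1, ?_⟩
  have hle := hX.2
  rwa [restrict_ground_eq, rk_restrict (A := G) hX.1, rk_restrict Set.sdiff_subset,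
    rk_restrict subset_rfl] at hle

lemma IsConnectedSet.not_isSeparator_singleton (hG : IsConnectedSet M G) (hG' : G.Nontrivial) :
    ¬ IsSeparator M G {e} := fun h =>
  (hG _ h).elim (Set.singleton_ne_empty e) fun heq => hG'.ne_singleton heq.symm

lemma IsConnectedSet.loopless [M.RankFinite] (hM : IsConnectedSet M M.E)
    (hE : M.E.Nontrivial) : M.Loopless := by
  refine loopless_iff_forall_not_isLoop.2 fun e he hloop => ?_
  refine hM.not_isSeparator_singleton hE (e := e) ⟨Set.singleton_subset_iff.2 he, ?_⟩
  rw [rk, hloop.eRk_eq, ENat.toNat_zero, zero_add]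
  exact rk_mono Set.sdiff_subset

lemma IsConnectedSet.not_isColoop [M.RankFinite] (hM : IsConnectedSet M M.E)
    (hE : M.E.Nontrivial) : ¬ M.IsColoop e := by
  intro h
  refine hM.not_isSeparator_singleton hE (e := e) ⟨Set.singleton_subset_iff.2 h.mem_ground, ?_⟩
  have hrk : M.rk {e} ≤ 1 := (rk_le_ncard (Set.finite_singleton e)).trans_eq
    (Set.ncard_singleton e)
  rw [isColoop_iff_sdiff_not_spanning, spanning_iff_eRk_le, ← eRk_ground, ← cast_rk, ← cast_rk,
    Nat.cast_le] at h
  omega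

lemma IsSeparator.rk_union_add_rk_union_le [M.RankFinite] (hG : G ⊆ M.E)
    (hW : IsSeparator (M ／ G) (M.E \ G) W) :
    M.rk (W ∪ G) + M.rk ((M.E \ G) \ W ∪ G) ≤ M.rk M.E + M.rk G := by
  have hle := hW.2
  have hrk := rk_contract_ground_add_rk hG
  rw [contract_ground] at hrk
  rw [← rk_contract_add_rk hG hW.1, ← rk_contract_add_rk hG Set.sdiff_subset]
  omega

lemma IsConnectedSet.union_separator [M.RankFinite] (hM : IsConnectedSet M M.E)
    (hG : IsConnectedSet M G) (hGE : G ⊆ M.E) (hne : G.Nonempty)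
    (hW : IsSeparator (M ／ G) (M.E \ G) W) : IsConnectedSet M (W ∪ G) := by
  refine hG.of_forall_separator Set.subset_union_right fun X hX hGX => ?_
  have hcontract := hW.rk_union_add_rk_union_le hGE
  set V := (M.E \ G) \ W
  have hWG : W ∪ G ⊆ M.E := Set.union_subset (hW.1.trans Set.sdiff_subset) hGE
  have hcompl : M.E \ ((W ∪ G) \ X) = X ∪ (V ∪ G) := by
    ext x
    have := @hX.1 x
    have := @hGX x
    have := @hWG x
    simp only [V, Set.mem_sdiff, Set.mem_union] at *
    tauto
  have hinter : X ∩ (V ∪ G) = G := by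
    ext x
    have := @hX.1 x
    have := @hGX x
    simp only [V, Set.mem_inter_iff, Set.mem_sdiff, Set.mem_union] at *
    tauto
  have hsep : IsSeparator M M.E ((W ∪ G) \ X) := by
    refine ⟨Set.sdiff_subset.trans hWG, ?_⟩
    have hsub := rk_inter_add_rk_union_le (M := M) X (V ∪ G)
    have hle := hX.2
    rw [hinter] at hsub
    rw [hcompl]
    omega
  rcases hM _ hsep with hempty | hfull
  · exact hX.1.antisymm (Set.sdiff_eq_empty.1 hempty)
  · obtain ⟨x, hx⟩ := hne
    exact absurd (hGX hx) (hfull.ge (hGE hx)).2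

/-- The connected non-spanning sets of `M`. In a connected matroid without loops, the maximal ones
are flats with connected contraction. -/
def IsConnectedNonspanning (M : Matroid α) (G : Set α) : Prop :=
  G ⊆ M.E ∧ IsConnectedSet M G ∧ M.rk G < M.rk M.E

lemma isFlat_of_maximal [M.RankFinite] [M.Loopless]
    (hG : Maximal (IsConnectedNonspanning M) G) : M.IsFlat G := by
  obtain ⟨hGE, hconn, hrk⟩ := hG.prop
  have hcl : IsConnectedNonspanning M (M.closure G) :=
    ⟨M.closure_subset_ground G, hconn.closure hGE, by rwa [rk_closure]⟩
  exact isFlat_iff_closure_eq.2 (hG.eq_of_subset hcl (M.subset_closure G hGE)).symm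

lemma isConnected_contract_of_maximal [M.RankFinite] (hM : IsConnectedSet M M.E)
    (hG : Maximal (IsConnectedNonspanning M) G) (hne : G.Nonempty) : (M ／ G).IsConnected := by
  obtain ⟨hGE, hconn, hrk⟩ := hG.prop
  have hspan : ∀ W, IsSeparator (M ／ G) (M.E \ G) W → W ≠ ∅ → M.rk M.E ≤ M.rk (W ∪ G) := by
    intro W hW hW₀
    by_contra! hlt
    have hWG : W ∪ G ⊆ G := hG.le_of_ge
      ⟨Set.union_subset (hW.1.trans Set.sdiff_subset) hGE,
        hM.union_separator hconn hGE hne hW, hlt⟩ Set.subset_union_right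
    obtain ⟨x, hx⟩ := Set.nonempty_iff_ne_empty.2 hW₀
    exact (hW.1 hx).2 (hWG (Or.inl hx))
  rw [isConnected_iff_isConnectedSet, contract_ground]
  intro W hW
  by_contra! hW'
  have hcompl : (M.E \ G) \ W ≠ ∅ := fun h => hW'.2 (hW.1.antisymm (Set.sdiff_eq_empty.1 h))
  have hle := hW.rk_union_add_rk_union_le hGE
  have h₁ := hspan W hW (Set.nonempty_iff_ne_empty.1 hW'.1)
  have h₂ := hspan _ hW.sdiff hcompl
  omega

lemma isSplitFlacet_of_maximal [M.Finite] (hM : IsConnectedSet M M.E)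
    (hG : Maximal (IsConnectedNonspanning M) G) (hdep : M.Dep G) : M.IsSplitFlacet G := by
  obtain ⟨hGE, hconn, hrk⟩ := hG.prop
  obtain ⟨x, hx⟩ := hdep.nonempty
  obtain ⟨e, heE, heG⟩ : ∃ e ∈ M.E, e ∉ G := by
    by_contra! h
    exact hrk.not_ge (rk_mono h)
  have hE : M.E.Nontrivial :=
    Set.nontrivial_of_mem_mem_ne (hGE hx) heE fun h => heG (h ▸ hx)
  have : M.Loopless := hM.loopless hE
  have hfin : G.Finite := M.set_finite G hGE
  refine ⟨isFlat_of_maximal hG, hconn.isConnected_restrict,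
    isConnected_contract_of_maximal hM hG ⟨x, hx⟩, Nat.pos_of_ne_zero fun h => ?_,
    (rk_le_ncard hfin).lt_of_ne fun h => hdep.not_indep ((indep_iff_rk_eq_ncard hfin).2 h),
    e, ⟨heE, heG⟩, hM.not_isColoop hE⟩
  have hloops : G ⊆ M.loops := by
    rw [← eRk_eq_zero_iff hGE, ← cast_rk, h, Nat.cast_zero]
  exact M.loops_eq_empty.subset (hloops hx)

lemma isStressed_closure_of_isCircuit [M.Finite] (hM : M.IsConnectedSplit)
    (hC : M.IsCircuit C) (hrk : M.rk C < M.rk M.E) : M.IsStressed (M.closure C) := by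
  have hfin : {G | IsConnectedNonspanning M G}.Finite :=
    M.ground_finite.powerset.subset fun G hG => hG.1
  obtain ⟨G, hCG, hG⟩ := hfin.exists_le_maximal
    (show C ∈ {G | IsConnectedNonspanning M G} from
      ⟨hC.subset_ground, isConnectedSet_of_isCircuit hC, hrk⟩)
  have hCG : C ⊆ G := hCG
  have hdep : M.Dep G := hC.dep.superset hCG hG.prop.1
  have hflacet : M.IsSplitFlacet G :=
    isSplitFlacet_of_maximal (isConnected_iff_isConnectedSet.1 hM.1) hG hdep
  have hstressed : M.IsStressed G := hM.2 G hflacet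
  have hrkC : M.rk G ≤ M.rk C := by
    have hmin := rk_eq_min_of_subset_stressed hstressed hCG
    have := rk_add_one_of_isCircuit hC
    omega
  have hclosure : M.closure C = G := by
    rw [(M.isRkFinite_set C).closure_eq_closure_of_subset_of_eRk_ge_eRk hCG
      (by rw [← cast_rk, ← cast_rk]; exact_mod_cast hrkC), hflacet.1.closure]
  rwa [hclosure]

lemma exists_isRaised_of_isConnectedSplit [M.Finite] (hM : M.IsConnectedSplit)
    (hA : M.Dep A) (hrk : M.rk A < M.rk M.E) : ∃ F, M.IsStressed F ∧ IsRaised M F A := by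
  obtain ⟨C, hCA, hC⟩ := hA.exists_isCircuit_subset
  have hF := isStressed_closure_of_isCircuit hM hC ((rk_mono hCA).trans_lt hrk)
  have hdep : M.Dep (A ∩ M.closure C) :=
    hC.dep.superset (Set.subset_inter hCA (M.subset_closure C hC.subset_ground))
      (Set.inter_subset_left.trans hA.subset_ground)
  exact ⟨_, hF, isRaised_of_dep_inter hF hA.subset_ground hdep hrk⟩

lemma isStressed_disjointSum_left (h : Disjoint M₁.E M₂.E) (h₁ : M₁.IsUniform)
    (h₂ : M₂.IsUniform) : (M₁.disjointSum M₂ h).IsStressed M₁.E :=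
  ⟨by simp, by rwa [disjointSum_restrict_left], by rwa [disjointSum_contract_left]⟩

lemma exists_isRaised_of_disjointSum (h : Disjoint M₁.E M₂.E) [(M₁.disjointSum M₂ h).Finite]
    (h₁ : M₁.IsUniform) (h₂ : M₂.IsUniform) (hA : (M₁.disjointSum M₂ h).Dep A)
    (hrk : (M₁.disjointSum M₂ h).rk A < (M₁.disjointSum M₂ h).rk (M₁.disjointSum M₂ h).E) :
    ∃ F, (M₁.disjointSum M₂ h).IsStressed F ∧ IsRaised (M₁.disjointSum M₂ h) F A := by
  have hs₁ := isStressed_disjointSum_left h h₁ h₂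
  have hs₂ : (M₁.disjointSum M₂ h).IsStressed M₂.E := by
    rw [disjointSum_comm]
    exact isStressed_disjointSum_left h.symm h₂ h₁
  have hAE := hA.subset_ground
  by_cases hdep : (M₁.disjointSum M₂ h).Dep (A ∩ M₁.E)
  · exact ⟨M₁.E, hs₁, isRaised_of_dep_inter hs₁ hAE hdep hrk⟩
  · refine ⟨M₂.E, hs₂, isRaised_of_dep_inter hs₂ hAE ?_ hrk⟩
    have hi₁ := (not_dep_iff (Set.inter_subset_left.trans hAE)).1 hdep
    refine (not_indep_iff (Set.inter_subset_left.trans hAE)).1 fun hi₂ => hA.not_indep ?_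
    have hcompl : A \ M₁.E ⊆ A ∩ M₂.E := fun x hx =>
      ⟨hx.1, (disjointSum_ground_eq.subset (hAE hx.1)).resolve_left hx.2⟩
    exact (isSeparator_disjointSum h).indep hAE hi₁ (hi₂.subset hcompl)

lemma exists_isRaised_of_isElementarySplit [M.Finite] (hM : M.IsElementarySplit) (hA : A ⊆ M.E)
    (hrk : M.rk A < min A.ncard (M.rk M.E)) : ∃ F, M.IsStressed F ∧ IsRaised M F A := by
  obtain ⟨hcard, hE⟩ := lt_min_iff.1 hrk
  have hdep : M.Dep A :=
    (not_indep_iff hA).1 fun hi => hcard.ne (rk_eq_ncard_of_indep hi)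
  rcases hM with hM | ⟨M₁, M₂, h, h₁, h₂, rfl⟩
  · exact exists_isRaised_of_isConnectedSplit hM hdep hE
  · exact exists_isRaised_of_disjointSum h h₁ h₂ hdep hE

end Connectivity

section Tutte

open MvPolynomial Finset

variable {α : Type*}

lemma sum_powerset_apply_card_inter_card_sdiff {R : Type*} [AddCommMonoid R] [DecidableEq α]
    {s u : Finset α} (hs : s ⊆ u) (f : ℕ → ℕ → R) :
    ∑ A ∈ u.powerset, f #(A ∩ s) #(A \ s) =
      ∑ i ∈ range (#s + 1), ∑ j ∈ range (#(u \ s) + 1),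
        ((#s).choose i * (#(u \ s)).choose j) • f i j := by
  have hprod : ∑ A ∈ u.powerset, f #(A ∩ s) #(A \ s) =
      ∑ p ∈ s.powerset ×ˢ (u \ s).powerset, f #p.1 #p.2 := by
    refine sum_nbij' (fun A => (A ∩ s, A \ s)) (fun p => p.1 ∪ p.2) ?_ ?_ ?_ ?_ fun A _ => rfl
    · intro A hA
      exact mem_product.2 ⟨mem_powerset.2 inter_subset_right,
        mem_powerset.2 (sdiff_subset_sdiff (mem_powerset.1 hA) subset_rfl)⟩
    · intro p hp
      simp only [mem_product, mem_powerset] at hp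
      exact mem_powerset.2 (union_subset (hp.1.trans hs) (hp.2.trans sdiff_subset))
    · intro A _
      exact sup_inf_sdiff A s
    · rintro ⟨P, Q⟩ hp
      simp only [mem_product, mem_powerset] at hp
      have hQ : Disjoint Q s := (subset_sdiff.1 hp.2).2
      ext1
      · simp only [union_inter_distrib_right, inter_eq_left.2 hp.1,
          disjoint_iff_inter_eq_empty.1 hQ, union_empty]
      · simp only [union_sdiff_distrib, sdiff_eq_empty_iff_subset.2 hp.1, hQ.sdiff_eq_left,
          empty_union]
  simp_rw [hprod, sum_product, sum_powerset_apply_card]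
  rw [sum_powerset_apply_card
    fun i => ∑ j ∈ range (#(u \ s) + 1), (#(u \ s)).choose j • f i j]
  simp_rw [smul_sum, mul_smul]

lemma sum_filter_powerset_apply_card_inter_card_sdiff {R : Type*} [AddCommMonoid R]
    [DecidableEq α] {s u : Finset α} (hs : s ⊆ u) (a b : ℕ) (f : ℕ → ℕ → R) :
    ∑ A ∈ u.powerset with a < #(A ∩ s) ∧ #(A \ s) < b, f #(A ∩ s) #(A \ s) =
      ∑ i ∈ Icc (a + 1) #s, ∑ j ∈ range b, ((#s).choose i * (#(u \ s)).choose j) • f i j := by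
  have hI : Icc (a + 1) #s = {i ∈ range (#s + 1) | a < i} := by
    ext i
    simp only [mem_Icc, mem_filter, mem_range]
    omega
  have hJ : ∀ i, ∑ j ∈ range b, ((#s).choose i * (#(u \ s)).choose j) • f i j =
      ∑ j ∈ range (#(u \ s) + 1) with j < b, ((#s).choose i * (#(u \ s)).choose j) • f i j := by
    intro i
    symm
    refine sum_subset (fun j hj => mem_range.2 (mem_filter.1 hj).2) fun j hj hj' => ?_
    have hlt : #(u \ s) < j := by
      simp only [mem_filter, mem_range, not_and] at hj hj'
      omega
    rw [Nat.choose_eq_zero_of_lt hlt, mul_zero, zero_smul]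
  simp_rw [hJ, hI, sum_filter]
  rw [sum_powerset_apply_card_inter_card_sdiff hs
    fun i j => if a < i ∧ j < b then f i j else 0]
  refine sum_congr rfl fun i _ => ?_
  split_ifs with hi <;> simp [hi]

/-- The summand of the Tutte polynomial of a matroid of rank `k` that belongs to a set of rank `s`
and cardinality `c`. -/
noncomputable def tutteTerm (k s c : ℕ) : MvPolynomial (Fin 2) ℤ :=
  (X 0 - 1) ^ (k - s) * (X 1 - 1) ^ (c - s)

lemma tutte_eq_sum_tutteTerm (M : Matroid α) [M.Finite] :
    M.tutte = ∑ A ∈ M.ground_finite.toFinset.powerset,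
      tutteTerm (M.rk M.E) (M.rk (A : Set α)) (A : Set α).ncard := by
  simp only [tutte, tutteTerm, Set.ncard_coe_finset]

lemma tutteTerm_add_tutteAlpha {r k i j : ℕ} (hi : r < i) (hj : j < k - r) :
    tutteTerm k (r + j) (i + j) + tutteAlpha r k i j = tutteTerm k (min (i + j) k) (i + j) := by
  unfold tutteTerm tutteAlpha
  split_ifs with h
  · have hx : k - (r + j) = (k - i - j) + (i - r) := by omega
    have hy : i + j - (r + j) = i - r := by omega
    rw [min_eq_left h, hx, hy, Nat.sub_self, Nat.sub_sub, pow_add, mul_pow]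
    ring
  · have hy : i + j - (r + j) = (i + j - k) + (k - r - j) := by omega
    rw [min_eq_right (not_le.1 h).le, hy, Nat.sub_self, Nat.sub_sub, pow_add, mul_pow]
    ring

lemma dvd_tutteAlpha (r k i j : ℕ) :
    (X 0 + X 1 - X 0 * X 1 : MvPolynomial (Fin 2) ℤ) ∣ tutteAlpha r k i j := by
  have hdvd : ∀ m : ℕ, (X 0 + X 1 - X 0 * X 1 : MvPolynomial (Fin 2) ℤ) ∣
      1 - ((X 0 - 1) * (X 1 - 1)) ^ m := fun m => by
    have hbase : (X 0 + X 1 - X 0 * X 1 : MvPolynomial (Fin 2) ℤ) =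
        1 - (X 0 - 1) * (X 1 - 1) := by ring
    rw [hbase]
    exact one_sub_dvd_one_sub_pow _ m
  unfold tutteAlpha
  split_ifs
  · exact (hdvd _).mul_left _
  · exact (hdvd _).mul_left _

/-- The change of the Tutte polynomial when a stressed subset of rank `r` and size `h` is relaxed
in a matroid of rank `k` on `n` elements. -/
noncomputable def tutteIncrement (k n r h : ℕ) : MvPolynomial (Fin 2) ℤ :=
  ∑ i ∈ Icc (r + 1) h, ∑ j ∈ range (k - r),
    ((h.choose i * (n - h).choose j : ℕ) : MvPolynomial (Fin 2) ℤ) * tutteAlpha r k i j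

lemma dvd_tutteIncrement (k n r h : ℕ) :
    (X 0 + X 1 - X 0 * X 1 : MvPolynomial (Fin 2) ℤ) ∣ tutteIncrement k n r h :=
  dvd_sum fun i _ => dvd_sum fun j _ => (dvd_tutteAlpha r k i j).mul_left _

lemma tutte_uniform_card {k : ℕ} {u : Finset α} (hk : k ≤ #u) :
    (uniform k #u).tutte = ∑ A ∈ u.powerset, tutteTerm k (min #A k) #A := by
  have hE : (uniform k #u).E = Set.univ := rfl
  have hfin : (uniform k #u).ground_finite.toFinset = univ := by
    ext
    simp [hE]
  have hterm : ∀ A : Finset (Fin #u), tutteTerm ((uniform k #u).rk (uniform k #u).E)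
      ((uniform k #u).rk (A : Set (Fin #u))) (A : Set (Fin #u)).ncard =
      tutteTerm k (min #A k) #A := by
    intro A
    rw [uniform_rk, uniform_rk, hE, Set.ncard_univ, Nat.card_fin, Set.ncard_coe_finset,
      min_eq_left hk, min_eq_right hk]
  rw [tutte_eq_sum_tutteTerm, hfin, sum_congr rfl fun A _ => hterm A,
    sum_powerset_apply_card (fun m => tutteTerm k (min m k) m),
    sum_powerset_apply_card (fun m => tutteTerm k (min m k) m), card_univ, Fintype.card_fin]

variable {M : Matroid α} [M.Finite] {F A : Set α}

lemma coe_subset_ground {A : Finset α} (hA : A ∈ M.ground_finite.toFinset.powerset) :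
    (A : Set α) ⊆ M.E :=
  M.ground_finite.subset_toFinset.1 (mem_powerset.1 hA)

open scoped Classical in
lemma sum_isRaised_tutteAlpha (hF : F ⊆ M.E) :
    ∑ A ∈ M.ground_finite.toFinset.powerset with IsRaised M F (A : Finset α),
      tutteAlpha (M.rk F) (M.rk M.E) ((A : Set α) ∩ F).ncard ((A : Set α) \ F).ncard =
    tutteIncrement (M.rk M.E) M.E.ncard (M.rk F) F.ncard := by
  lift F to Finset α using M.set_finite F hF
  have hFE : F ⊆ M.ground_finite.toFinset := M.ground_finite.subset_toFinset.2 hF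
  have hcard : #(M.ground_finite.toFinset \ F) = M.E.ncard - #F := by
    rw [card_sdiff_of_subset hFE, Set.ncard_eq_toFinset_card M.E M.ground_finite]
  have hsum := sum_filter_powerset_apply_card_inter_card_sdiff hFE (M.rk F)
    (M.rk M.E - M.rk F) (tutteAlpha (M.rk F) (M.rk M.E))
  simp only [hcard, nsmul_eq_mul] at hsum
  simp only [tutteIncrement, IsRaised, ← coe_inter, ← coe_sdiff, Set.ncard_coe_finset]
  convert! hsum

lemma IsRaised.tutteTerm_add_tutteAlpha (h : IsRaised M F A) (hF : M.IsStressed F)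
    (hA : A ⊆ M.E) :
    tutteTerm (M.rk M.E) (M.rk A) A.ncard +
        tutteAlpha (M.rk F) (M.rk M.E) (A ∩ F).ncard (A \ F).ncard =
      tutteTerm (M.rk M.E) (min A.ncard (M.rk M.E)) A.ncard := by
  rw [h.rk_eq hF hA, ← ncard_inter_add_ncard_sdiff hA F,
    TutteRelaxation.tutteTerm_add_tutteAlpha h.1 h.2]

lemma relax_tutte (hF : M.IsStressed F) :
    (M.relax F hF).tutte =
      M.tutte + tutteIncrement (M.rk M.E) M.E.ncard (M.rk F) F.ncard := by
  classical
  have hground : (M.relax F hF).E = M.E := rfl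
  rw [← sum_isRaised_tutteAlpha hF.1, tutte_eq_sum_tutteTerm, tutte_eq_sum_tutteTerm M,
    sum_filter, ← sum_add_distrib]
  refine sum_congr rfl fun A hA => ?_
  have hAE : (A : Set α) ⊆ M.E := coe_subset_ground hA
  rw [hground, relax_rk_ground]
  split_ifs with h
  · rw [h.relax_rk hF hAE, h.tutteTerm_add_tutteAlpha hF hAE]
  · rw [relax_rk_of_not_isRaised hF hAE h, add_zero]

/-- The stressed subsets of `M` with non-empty cusp; `λ_{r,h}` counts those of rank `r` and
size `h`. -/
noncomputable def cuspidalSets (M : Matroid α) [M.Finite] : Finset (Set α) :=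
  (M.ground_finite.powerset.subset fun _ hF => hF.1.1 :
    {F | M.IsStressed F ∧ (M.cusp F).Nonempty}.Finite).toFinset

lemma mem_cuspidalSets : F ∈ cuspidalSets M ↔ M.IsStressed F ∧ (M.cusp F).Nonempty :=
  Set.Finite.mem_toFinset _

lemma IsRaised.mem_cuspidalSets (h : IsRaised M F A) (hF : M.IsStressed F) (hA : A ⊆ M.E) :
    F ∈ cuspidalSets M := by
  obtain ⟨S, hS, -⟩ := h.exists_mem_cusp hA
  exact TutteRelaxation.mem_cuspidalSets.2 ⟨hF, S, hS⟩

open scoped Classical in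
lemma tutteTerm_add_sum_tutteAlpha_of_isElementarySplit (hM : M.IsElementarySplit)
    (hA : A ⊆ M.E) :
    tutteTerm (M.rk M.E) (M.rk A) A.ncard + ∑ F ∈ cuspidalSets M with IsRaised M F A,
        tutteAlpha (M.rk F) (M.rk M.E) (A ∩ F).ncard (A \ F).ncard =
      tutteTerm (M.rk M.E) (min A.ncard (M.rk M.E)) A.ncard := by
  by_cases hlt : M.rk A < min A.ncard (M.rk M.E)
  · obtain ⟨F, hF, hFA⟩ := exists_isRaised_of_isElementarySplit hM hA hlt
    have hunique : {G ∈ cuspidalSets M | IsRaised M G A} = {F} := by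
      ext G
      rw [mem_filter, mem_singleton]
      constructor
      · rintro ⟨hG, hGA⟩
        exact hGA.unique hFA (mem_cuspidalSets.1 hG).1 hF hA
      · rintro rfl
        exact ⟨hFA.mem_cuspidalSets hF hA, hFA⟩
    rw [hunique, sum_singleton, hFA.tutteTerm_add_tutteAlpha hF hA]
  · have hnone : {F ∈ cuspidalSets M | IsRaised M F A} = ∅ :=
      filter_false_of_mem fun F hF h => hlt (h.rk_lt (mem_cuspidalSets.1 hF).1 hA)
    have hrk : M.rk A = min A.ncard (M.rk M.E) :=
      le_antisymm (le_min (rk_le_ncard (M.set_finite A hA)) (rk_mono hA)) (not_lt.1 hlt)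
    rw [hnone, sum_empty, add_zero, hrk]

lemma card_filter_cuspidalSets (M : Matroid α) [M.Finite] (r h : ℕ) :
    #{F ∈ cuspidalSets M | (M.rk F, F.ncard) = (r, h)} = M.numStressed r h := by
  rw [numStressed, ← Set.ncard_coe_finset]
  congr 1
  ext F
  simp [mem_cuspidalSets, and_assoc]

lemma sum_cuspidalSets {R : Type*} [AddCommMonoid R] (M : Matroid α) [M.Finite]
    (f : ℕ → ℕ → R) :
    ∑ F ∈ cuspidalSets M, f (M.rk F) F.ncard = ∑ r ∈ range (M.rk M.E + 1),
      ∑ h ∈ range (M.E.ncard + 1), M.numStressed r h • f r h := by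
  have hmaps : ∀ F ∈ cuspidalSets M,
      (M.rk F, F.ncard) ∈ range (M.rk M.E + 1) ×ˢ range (M.E.ncard + 1) := by
    intro F hF
    have hFE := (mem_cuspidalSets.1 hF).1.1
    exact mem_product.2 ⟨mem_range_succ_iff.2 (rk_mono hFE),
      mem_range_succ_iff.2 (Set.ncard_le_ncard hFE M.ground_finite)⟩
  rw [← sum_fiberwise_of_maps_to hmaps, sum_product]
  refine sum_congr rfl fun r _ => sum_congr rfl fun h _ => ?_
  rw [← card_filter_cuspidalSets, ← sum_const]
  refine sum_congr rfl fun F hF => ?_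
  obtain ⟨hr, hh⟩ := Prod.mk.inj (mem_filter.1 hF).2
  rw [hr, hh]

lemma tutte_add_sum_tutteIncrement_of_isElementarySplit (hM : M.IsElementarySplit) :
    M.tutte + ∑ F ∈ cuspidalSets M, tutteIncrement (M.rk M.E) M.E.ncard (M.rk F) F.ncard =
      (uniform (M.rk M.E) M.E.ncard).tutte := by
  classical
  have hk : M.rk M.E ≤ #M.ground_finite.toFinset := by
    rw [← Set.ncard_eq_toFinset_card M.E M.ground_finite]
    exact rk_le_ncard M.ground_finite
  have hincr : ∀ F ∈ cuspidalSets M,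
      tutteIncrement (M.rk M.E) M.E.ncard (M.rk F) F.ncard =
        ∑ A ∈ M.ground_finite.toFinset.powerset with IsRaised M F (A : Finset α),
          tutteAlpha (M.rk F) (M.rk M.E) ((A : Set α) ∩ F).ncard ((A : Set α) \ F).ncard :=
    fun F hF => (sum_isRaised_tutteAlpha (mem_cuspidalSets.1 hF).1.1).symm
  rw [sum_congr rfl hincr]
  simp_rw [sum_filter]
  rw [sum_comm, tutte_eq_sum_tutteTerm, ← sum_add_distrib,
    Set.ncard_eq_toFinset_card M.E M.ground_finite, tutte_uniform_card hk]
  refine sum_congr rfl fun A hA => ?_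
  rw [← sum_filter, ← Set.ncard_coe_finset A]
  exact tutteTerm_add_sum_tutteAlpha_of_isElementarySplit hM (coe_subset_ground hA)

lemma tutte_of_isElementarySplit (hM : M.IsElementarySplit) :
    M.tutte = (uniform (M.rk M.E) M.E.ncard).tutte -
      ∑ r ∈ range (M.rk M.E + 1), ∑ h ∈ range (M.E.ncard + 1),
        (M.numStressed r h : MvPolynomial (Fin 2) ℤ) *
          tutteIncrement (M.rk M.E) M.E.ncard r h := by
  simp_rw [← nsmul_eq_mul]
  rw [← sum_cuspidalSets M (tutteIncrement (M.rk M.E) M.E.ncard), eq_sub_iff_add_eq]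
  exact tutte_add_sum_tutteIncrement_of_isElementarySplit hM

end Tutte

end TutteRelaxation

/-- The change of the Tutte polynomial under relaxation of a stressed subset with non-empty cusp,
and the resulting formula for the Tutte polynomial of an elementary split matroid. In the last sum
`r` and `h` run over all values for which `λ_{r,h}` can be non-zero. -/
theorem theorem6p3 {α : Type*} (M : Matroid α) [M.Finite] (k n : ℕ)
    (hk : M.rk M.E = k) (hn : M.E.ncard = n) :
    (∀ (F : Set α) (hF : M.IsStressed F) (r h : ℕ), (M.cusp F).Nonempty →
        M.rk F = r → F.ncard = h →
        (M.relax F hF).tutte = M.tutte +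
            ∑ i ∈ Finset.Icc (r + 1) h, ∑ j ∈ Finset.range (k - r),
              ((h.choose i * (n - h).choose j : ℕ) : MvPolynomial (Fin 2) ℤ) *
                Matroid.tutteAlpha r k i j ∧
        (MvPolynomial.X 0 + MvPolynomial.X 1 - MvPolynomial.X 0 * MvPolynomial.X 1 :
            MvPolynomial (Fin 2) ℤ) ∣ (M.relax F hF).tutte - M.tutte) ∧
    (M.IsElementarySplit →
        M.tutte = (Matroid.uniform k n).tutte -
          ∑ r ∈ Finset.range (k + 1), ∑ h ∈ Finset.range (n + 1),
            (M.numStressed r h : MvPolynomial (Fin 2) ℤ) *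
              ∑ i ∈ Finset.Icc (r + 1) h, ∑ j ∈ Finset.range (k - r),
                ((h.choose i * (n - h).choose j : ℕ) : MvPolynomial (Fin 2) ℤ) *
                  Matroid.tutteAlpha r k i j) := by
  subst hk hn
  refine ⟨?_, TutteRelaxation.tutte_of_isElementarySplit⟩
  rintro F hF r h - rfl rfl
  have hrelax := TutteRelaxation.relax_tutte hF
  refine ⟨hrelax, ?_⟩
  rw [hrelax, add_sub_cancel_left]
  exact TutteRelaxation.dvd_tutteIncrement _ _ _ _
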